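/- All groups are finite. Let $p$ be a prime, $G$ a finite group and $P$ a Sylow $p$-subgroup of $G$. Let $Z^*(P)=\bigcap_{H\le P}N_P(H)$ be the norm of $P$. For a Sylow $p$-subgroup $Q$ of $G$, call $P\cap Q$ a \emph{tame intersection} if $N_P(P\cap Q)$ and $N_Q(P\cap Q)$ are both Sylow $p$-subgroups of $N_G(P\cap Q)$. A group is \emph{$p$-nilpotent} if it has a normal Hall $p'$-subgroup, i.e. a normal subgroup of order prime to $p$ and of $p$-power index. For a group $X$, let $A^p(X)$ be the smallest normal subgroup of $X$ whose quotient is an abelian $p$-group; a subgroup $N\le G$ with $|G:N|$ coprime to $p$ \emph{controls $p$-transfer} in $G$ if $N/A^p(N)\cong G/A^p(G)$. Theorem. Suppose that for every Sylow $p$-subgroup $Q$ of $G$ such that $P\cap Q$ is a tame intersection and $Z^*(P)<P\cap Q<P$ (strict inclusions), the group $N_G(P\cap Q)$ is $p$-nilpotent. Then $N_G(P)$ controls $p$-transfer in $G$ (in particular $|G:N_G(P)|$ is coprime to $p$). -/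

import Mathlib

namespace PTransfer

/-- `A^p(G)`: the smallest normal subgroup of the (finite) group `G` whose quotient is an
abelian `p`-group, as the intersection of all such normal subgroups. -/
def abelianPResidual (p : ℕ) (G : Type*) [Group G] : Subgroup G :=
  sInf {K : Subgroup G | ∃ _ : K.Normal,
    IsPGroup p (G ⧸ K) ∧ ∀ a b : G ⧸ K, a * b = b * a}

instance abelianPResidual_normal (p : ℕ) (G : Type*) [Group G] :
    (abelianPResidual p G).Normal := by
  refine ⟨fun n hn g => ?_⟩
  rw [abelianPResidual, Subgroup.mem_sInf] at hn ⊢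
  intro K hK
  exact hK.1.conj_mem n (hn K hK) g

/-- The subgroup `N` of `G`, of index coprime to `p`, controls `p`-transfer in `G`:
`N / A^p(N) ≅ G / A^p(G)`. -/
def ControlsPTransfer (p : ℕ) {G : Type*} [Group G] (N : Subgroup G) : Prop :=
  p.Coprime N.index ∧
    Nonempty ((N ⧸ abelianPResidual p N) ≃* (G ⧸ abelianPResidual p G))

/-- The (finite) group `G` is `p`-nilpotent: it has a normal Hall `p'`-subgroup, that is, a normal
subgroup of order coprime to `p` whose index is a power of `p`. -/
def IsPNilpotent (p : ℕ) (G : Type*) [Group G] : Prop :=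
  ∃ K : Subgroup G, K.Normal ∧ p.Coprime (Nat.card K) ∧ ∃ n : ℕ, K.index = p ^ n

/-- The norm of a group: the intersection of the normalizers of all its subgroups. -/
def groupNorm (G : Type*) [Group G] : Subgroup G :=
  ⨅ H : Subgroup G, Subgroup.normalizer (H : Set G)

/-- `P ∩ Q` is a tame intersection: `N_P(P ∩ Q)` and `N_Q(P ∩ Q)` are Sylow `p`-subgroups
of `N_G(P ∩ Q)`. Here `N_P(P ∩ Q) = P ∩ N_G(P ∩ Q)` is regarded as a subgroup of
`N_G(P ∩ Q)`. -/
def IsTameIntersection {p : ℕ} {G : Type*} [Group G] (P Q : Sylow p G) : Prop :=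
  let N : Subgroup G := Subgroup.normalizer (((P : Subgroup G) ⊓ (Q : Subgroup G) : Subgroup G) : Set G)
  (∃ S : Sylow p N, (S : Subgroup N) = (P : Subgroup G).subgroupOf N) ∧
    (∃ S : Sylow p N, (S : Subgroup N) = (Q : Subgroup G).subgroupOf N)

end PTransfer

/-!
Write `N = N_G(P)`, `Z = Z^*(P)` and `W = A^p(G)`. Composing the inclusion with the quotient map
gives a surjection `N → G / W`, and control of `p`-transfer amounts to its kernel `N ∩ W` being no
larger than `A^p(N)`.

*Targets of order `p` suffice* (`controlsPTransfer_of_forall`). Let `B = (N ∩ W) / A^p(N)`, the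
kernel of `π : N / A^p(N) → G / W`, and let `V : G → N / A^p(N)` be the transfer. Then
`π (V g) = π (g) ^ |G : N|`, so `g ↦ g ^ |G : N| * V(g)⁻¹` maps `N` into `B`; it is the
`|G : N|`-th power map on `N ∩ W`, because `V` kills `W`. If `B ≠ 1`, following it by a map of `B`
onto a group of order `p` gives a homomorphism from `N` to a group of order `p` that does not kill
`N ∩ W`.

*Evaluating the transfer* (`apply_eq_one_of_mem`). Let `φ : N → A` with `|A| = p`, and suppose
that `x ∈ P ∩ W` is an element of least order with `φ x ≠ 1`. In the orbit formula for the transfer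
of `x`, which is `1` since `x ∈ W`, every orbit of length `k > 1` contributes the value of `φ` at a
conjugate of `x ^ k`, which is trivial by minimality. What is left is the product of `φ (g⁻¹ x g)`
over the cosets `gN` fixed by `x`. The coset `N` contributes `φ x`, and every other `P`-orbit of
cosets contributes `1`, so that `φ x = 1`.

*Nontrivial orbits* (`exists_prod_conj_eq_one`). Let `D = P ∩ g P g⁻¹ < P` be the stabilizer of
`gN` in `P`, and `λ y = φ (g⁻¹ y g)` on `D`. If `s ∈ N_P(D) \ D` with `s ^ p ∈ D`, then right
multiplication by `s` cuts the orbit `P / D` into cycles of length `p`, and it is enough that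
`∏ λ (s⁻ⁱ y sⁱ) = 1` over `i < p`, for all `y ∈ D`. Such an `s` exists in each of three cases.
- `Z ≰ D`: take `s ∈ Z`. It normalizes `D` and `ker λ`, and so fixes `λ`.
- `D = Z`: take any `s`. As `y` normalizes `⟨s⟩`, `s⁻¹ y s = y w` with `w ∈ ⟨s⟩`, and the product
  is `λ (w) ^ (p (p - 1) / 2)`. For `p = 2` this is `λ w`, which is shown to be trivial by
  comparing `s` with `s y`.
- `Z < D`: by the fusion theorem `actsAsNormalizer_of_lt`, conjugation by `g⁻¹` on `D` agrees with
  conjugation by an element of `N`, so `λ = φ` on `D`, which is invariant under `P`.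

*Fusion* (`actsAsNormalizer_of_lt`). This follows the proof of Alperin's theorem, restricted to
subgroups strictly above `Z`. The `p`-nilpotent normalizers act on the tame intersections as
elements of `P` do; and since `N` normalizes `Z`, conjugates of a subgroup that arise in the
induction stay strictly above `Z`.
-/

namespace PTransfer

/-! ### Products over cosets -/

/-- Starting from any element of `H \ D`, take its last iterated `p`-th power outside `D`. -/
theorem exists_mem_notMem_pow_mem {p : ℕ} {Γ : Type*} [Group Γ] (hΓ : IsPGroup p Γ)
    {D H : Subgroup Γ} (hH : ¬ H ≤ D) : ∃ s ∈ H, s ∉ D ∧ s ^ p ∈ D := by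
  classical
  obtain ⟨v, hvH, hvD⟩ := SetLike.not_le_iff_exists.mp hH
  have hex : ∃ k, v ^ p ^ k ∈ D := by
    obtain ⟨k, hk⟩ := hΓ v
    exact ⟨k, hk ▸ D.one_mem⟩
  have h0 : Nat.find hex ≠ 0 := by
    intro h0
    have := Nat.find_spec hex
    rw [h0] at this
    simp [hvD] at this
  obtain ⟨k, hk⟩ := Nat.exists_eq_succ_of_ne_zero h0
  refine ⟨v ^ p ^ k, H.pow_mem hvH _, Nat.find_min hex (by omega), ?_⟩
  have := Nat.find_spec hex
  rwa [hk, pow_succ, pow_mul] at this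

/-- All cycles of `σ` have length exactly `p`, so the product splits into products over cycles. -/
theorem prod_eq_one_of_perm {p : ℕ} (hp : p.Prime) {X A : Type*} [Fintype X] [CommMonoid A]
    (σ : Equiv.Perm X) (hσ : σ ^ p = 1) (hfix : ∀ c, σ c ≠ c) (F : X → A)
    (hF : ∀ c, ∏ i ∈ Finset.range p, F ((σ ^ i) c) = 1) : ∏ c, F c = 1 := by
  classical
  let S := Equiv.Perm.SameCycle.setoid σ
  rw [← Finset.prod_fiberwise (s := Finset.univ) (g := fun c => (Quotient.mk S c))]
  refine Finset.prod_eq_one fun q _ => ?_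
  obtain ⟨c, rfl⟩ := Quotient.exists_rep q
  rw [← hF c]
  have hper : Function.minimalPeriod σ c = p := by
    have h1 : Function.minimalPeriod σ c ∣ p := by
      apply Function.IsPeriodicPt.minimalPeriod_dvd
      change σ^[p] c = c
      rw [← Equiv.Perm.coe_pow, hσ]; rfl
    rcases (Nat.dvd_prime hp).mp h1 with h | h
    · exact absurd (Function.minimalPeriod_eq_one_iff_isFixedPt.mp h) (hfix c)
    · exact h
  have hinj : Set.InjOn (fun i : ℕ => (σ ^ i) c) (Finset.range p : Set ℕ) := by
    intro i hi j hj hij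
    simp only [Finset.coe_range, Set.mem_Iio] at hi hj
    refine Function.iterate_injOn_Iio_minimalPeriod (f := σ) (x := c) (by simpa [hper] using hi)
      (by simpa [hper] using hj) ?_
    simpa [Equiv.Perm.coe_pow] using hij
  rw [← Finset.prod_image (f := F) (g := fun i : ℕ => (σ ^ i) c) hinj]
  refine Finset.prod_congr ?_ fun _ _ => rfl
  ext d
  simp only [Finset.mem_filter, Finset.mem_univ, true_and, Finset.mem_image, Finset.mem_range]
  constructor
  · intro h
    have h' : σ.SameCycle d c := Quotient.exact h
    obtain ⟨i, hi⟩ := h'.symm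
    have hp0 : (p : ℤ) ≠ 0 := by exact_mod_cast hp.ne_zero
    refine ⟨(i % p).toNat, ?_, ?_⟩
    · have := Int.emod_lt_of_pos i (by exact_mod_cast hp.pos : (0 : ℤ) < p)
      have := Int.emod_nonneg i hp0
      omega
    · rw [← hi, ← zpow_natCast, Int.toNat_of_nonneg (Int.emod_nonneg i hp0)]
      conv_rhs => rw [← Int.emod_add_mul_ediv i p, zpow_add, zpow_mul, zpow_natCast, hσ]
      simp
  · rintro ⟨i, -, rfl⟩
    exact Quotient.sound (show σ.SameCycle ((σ ^ i) c) c from ⟨-i, by simp⟩)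

/-- Right multiplication by `s` is a well-defined permutation of `Γ / D`, all of whose cycles have
length `p`. -/
theorem prod_quotient_eq_one {p : ℕ} (hp : p.Prime) {Γ A : Type*} [Group Γ] [CommMonoid A]
    (D : Subgroup Γ) [Fintype (Γ ⧸ D)] {s : Γ} (hs : s ∈ Subgroup.normalizer (D : Set Γ))
    (hsD : s ∉ D) (hsp : s ^ p ∈ D) (F : Γ ⧸ D → A)
    (hF : ∀ u : Γ, ∏ i ∈ Finset.range p, F ((u * s ^ i : Γ) : Γ ⧸ D) = 1) : ∏ c, F c = 1 := by
  have hnorm := Subgroup.mem_normalizer_iff.mp hs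
  let σ : Equiv.Perm (Γ ⧸ D) :=
    { toFun := Quotient.map' (· * s) fun a b h => by
        rw [QuotientGroup.leftRel_apply] at h ⊢
        have := (hnorm (s⁻¹ * (a⁻¹ * b) * s)).mpr (by simpa [mul_assoc] using h)
        simpa [mul_assoc] using this
      invFun := Quotient.map' (· * s⁻¹) fun a b h => by
        rw [QuotientGroup.leftRel_apply] at h ⊢
        have := (hnorm (a⁻¹ * b)).mp h
        simpa [mul_assoc] using this
      left_inv := by
        intro c; induction c using Quotient.inductionOn' with | h u => simp
      right_inv := by
        intro c; induction c using Quotient.inductionOn' with | h u => simp }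
  have hσ1 : ∀ u : Γ, σ (u : Γ ⧸ D) = ((u * s : Γ) : Γ ⧸ D) := fun u => rfl
  have hσ : ∀ (i : ℕ) (u : Γ), (σ ^ i) (u : Γ ⧸ D) = ((u * s ^ i : Γ) : Γ ⧸ D) := by
    intro i
    induction i with
    | zero => intro u; simp
    | succ i ih => intro u; rw [pow_succ', Equiv.Perm.mul_apply, ih, hσ1, mul_assoc, ← pow_succ]
  refine prod_eq_one_of_perm hp σ ?_ ?_ F ?_
  · ext c
    induction c using QuotientGroup.induction_on with | H u =>
    rw [hσ, Equiv.Perm.one_apply, QuotientGroup.eq]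
    simpa using D.inv_mem hsp
  · intro c
    induction c using QuotientGroup.induction_on with | H u =>
    rw [hσ1, Ne, QuotientGroup.eq]
    simpa using hsD
  · intro c
    induction c using QuotientGroup.induction_on with | H u =>
    simpa only [hσ] using hF u

/-! ### The norm of a group acting on homomorphisms to a group of prime order -/

theorem norm_mem_normalizer {Γ : Type*} [Group Γ] {s : Γ} (hs : s ∈ groupNorm Γ)
    (H : Subgroup Γ) : s ∈ Subgroup.normalizer (H : Set Γ) :=
  (Subgroup.mem_iInf.mp hs) H

/-- An element `s` of the norm normalizes `ker l`, so it acts on the image of `l` as `a ↦ a ^ j` for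
some `j`. Since `s ^ p ∈ D` acts trivially, `j ^ p ≡ 1`, and `j ^ p ≡ j` modulo `p`. -/
theorem apply_conj_eq_of_mem_groupNorm {p : ℕ} (hp : p.Prime) {Γ A : Type*} [Group Γ]
    [CommGroup A] (hA : Nat.card A = p) {D : Subgroup Γ} (l : D →* A) {s : Γ}
    (hs : s ∈ groupNorm Γ) (hsp : s ^ p ∈ D) {y : Γ} (hy : y ∈ D) (hy' : s⁻¹ * y * s ∈ D) :
    l ⟨s⁻¹ * y * s, hy'⟩ = l ⟨y, hy⟩ := by
  have := Fact.mk hp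
  have hD := Subgroup.mem_normalizer_iff''.mp (norm_mem_normalizer hs D)
  have hK := Subgroup.mem_normalizer_iff''.mp (norm_mem_normalizer hs (l.ker.map D.subtype))
  have hK' : ∀ (a : Γ) (ha : a ∈ D) (hb : s⁻¹ * a * s ∈ D),
      l ⟨a, ha⟩ = 1 → l ⟨s⁻¹ * a * s, hb⟩ = 1 := by
    intro a ha hb h1
    obtain ⟨b, hb1, hb2⟩ := (hK a).mp ⟨⟨a, ha⟩, h1, rfl⟩
    rw [← show b = ⟨s⁻¹ * a * s, hb⟩ from Subtype.ext hb2]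
    exact hb1
  by_cases h1 : l ⟨y, hy⟩ = 1
  · rw [h1, hK' y hy hy' h1]
  have hgen : ∀ a : A, ∃ j : ℕ, l ⟨y, hy⟩ ^ j = a := fun a => by
    have := mem_powers_of_prime_card (p := p) hA (g := l ⟨y, hy⟩) (g' := a) h1
    exact this
  obtain ⟨j, hj⟩ := hgen (l ⟨s⁻¹ * y * s, hy'⟩)
  have hpow : ∀ i : ℕ, ∃ h : (s ^ i)⁻¹ * y * s ^ i ∈ D,
      l ⟨(s ^ i)⁻¹ * y * s ^ i, h⟩ = l ⟨y, hy⟩ ^ (j ^ i) := by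
    intro i
    induction i with
    | zero => exact ⟨by simpa using hy, by simp⟩
    | succ i ih =>
      obtain ⟨h, hi⟩ := ih
      have e : (s ^ (i + 1))⁻¹ * y * s ^ (i + 1) = s⁻¹ * ((s ^ i)⁻¹ * y * s ^ i) * s := by
        rw [pow_succ]; group
      have h2 : s⁻¹ * ((s ^ i)⁻¹ * y * s ^ i) * s ∈ D := (hD _).mp h
      refine ⟨e ▸ h2, ?_⟩
      have hq : ((s ^ i)⁻¹ * y * s ^ i) * (y ^ (j ^ i))⁻¹ ∈ D :=
        D.mul_mem h (D.inv_mem (D.pow_mem hy _))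
      have hk : l ⟨((s ^ i)⁻¹ * y * s ^ i) * (y ^ (j ^ i))⁻¹, hq⟩ = 1 := by
        have : (⟨((s ^ i)⁻¹ * y * s ^ i) * (y ^ (j ^ i))⁻¹, hq⟩ : D) =
            ⟨_, h⟩ * (⟨y, hy⟩ ^ (j ^ i))⁻¹ := rfl
        rw [this, map_mul, map_inv, map_pow, hi, mul_inv_cancel]
      have hq' := (hD _).mp hq
      have hk' := hK' _ hq hq' hk
      have : (⟨s⁻¹ * (((s ^ i)⁻¹ * y * s ^ i) * (y ^ (j ^ i))⁻¹) * s, hq'⟩ : D) =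
          ⟨_, h2⟩ * (⟨s⁻¹ * y * s, hy'⟩ ^ (j ^ i))⁻¹ := by
        apply Subtype.ext
        have : (s⁻¹ * y * s) ^ (j ^ i) = s⁻¹ * y ^ (j ^ i) * s := by
          simpa using conj_pow (a := s⁻¹) (b := y) (i := j ^ i)
        simp only [Subgroup.coe_mul, Subgroup.coe_inv, Subgroup.coe_pow, this]
        group
      rw [this, map_mul, map_inv, map_pow, mul_inv_eq_one, ← hj, ← pow_mul, ← pow_succ'] at hk'
      simp only [e, hk']
  obtain ⟨h, hp'⟩ := hpow p
  have e : (⟨(s ^ p)⁻¹ * y * s ^ p, h⟩ : D) = ⟨s ^ p, hsp⟩⁻¹ * ⟨y, hy⟩ * ⟨s ^ p, hsp⟩ := rfl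
  rw [e, map_mul, map_mul, map_inv, mul_comm, mul_inv_cancel_left] at hp'
  have hord : orderOf (l ⟨y, hy⟩) = p := orderOf_eq_prime (by rw [← hA]; exact pow_card_eq_one') h1
  rw [← hj]
  conv_rhs => rw [hp']
  rw [pow_eq_pow_iff_modEq, hord, ← ZMod.natCast_eq_natCast_iff]
  simp

instance groupNorm_normal (Γ : Type*) [Group Γ] : (groupNorm Γ).Normal := by
  refine ⟨fun n hn g => ?_⟩
  rw [groupNorm, Subgroup.mem_iInf] at hn ⊢
  intro H
  have h := hn (H.comap (MulAut.conj g).toMonoidHom)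
  rw [Subgroup.mem_normalizer_iff] at h ⊢
  intro x
  have := h (g⁻¹ * x * g)
  simpa [mul_assoc] using this

/-- An element of the norm normalizes `⟨s⟩`. -/
theorem conj_eq_mul_zpow {Γ : Type*} [Group Γ] {s y : Γ} (hy : y ∈ groupNorm Γ) :
    ∃ j : ℤ, s⁻¹ * y * s = y * s ^ j := by
  have h := (Subgroup.mem_normalizer_iff''.mp (norm_mem_normalizer hy (Subgroup.zpowers s)) s).mp
    (Subgroup.mem_zpowers s)
  obtain ⟨j, hj⟩ := Subgroup.mem_zpowers_iff.mp h
  refine ⟨1 - j, ?_⟩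
  rw [sub_eq_neg_add, zpow_add, zpow_neg, hj]
  group

theorem mul_eq_one_of_card_two {A : Type*} [Group A] (hA : Nat.card A = 2) {a b : A}
    (ha : a ≠ 1) (hb : b ≠ 1) : a * b = 1 := by
  have : Finite A := Nat.finite_of_card_ne_zero (by omega)
  have := Fintype.ofFinite A
  by_contra h
  classical
  have hne : b ≠ a⁻¹ := fun e => h (by rw [e, mul_inv_cancel])
  have : ({1, b, a⁻¹} : Finset A).card ≤ 2 := by
    rw [← hA, Nat.card_eq_fintype_card]; exact Finset.card_le_univ _
  rw [Finset.card_eq_three.mpr ⟨1, b, a⁻¹, hb.symm, (inv_ne_one.mpr ha).symm, hne, rfl⟩] at this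
  omega

theorem prime_dvd_of_zpow_mem {Γ : Type*} [Group Γ] {D : Subgroup Γ} {p : ℕ} (hp : p.Prime) {s : Γ}
    (hs : s ∉ D) (hsp : s ^ p ∈ D) {j : ℤ} (hj : s ^ j ∈ D) : (p : ℤ) ∣ j := by
  by_contra h
  have hg : Int.gcd j p = 1 := by
    rw [Int.gcd_comm]
    exact Int.isCoprime_iff_gcd_eq_one.mp
      ((Nat.prime_iff_prime_int.mp hp).coprime_iff_not_dvd.mpr h)
  apply hs
  have hb := Int.gcd_eq_gcd_ab j p
  rw [hg] at hb
  have : s = (s ^ j) ^ (Int.gcdA j p) * (s ^ p) ^ (Int.gcdB j p) := by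
    rw [← zpow_natCast s p, ← zpow_mul, ← zpow_mul, ← zpow_add, ← hb]; simp
  rw [this]
  exact D.mul_mem (D.zpow_mem hj _) (D.zpow_mem hsp _)

/-- The case `p = 2` of `prod_conj_groupNorm_eq_one`. Here `w` is a power of `s ^ 2`, so if
`l w ≠ 1` then `l w = l (s ^ 2)`. With `s y` in place of `s`, the element `w` becomes a conjugate of
`w`, while `(s y) ^ 2` has image `l (s ^ 2) * l w * l y ^ 2 = 1`, a contradiction. -/
theorem apply_eq_one_of_sq_mem {Γ A : Type*} [Group Γ]
    [CommGroup A] (hA : Nat.card A = 2) (l : groupNorm Γ →* A) {s y : Γ}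
    (hs : s ∉ groupNorm Γ) (hs2 : s ^ 2 ∈ groupNorm Γ) (hy : y ∈ groupNorm Γ)
    (w : groupNorm Γ) (hw : s⁻¹ * y * s = y * w) : l w = 1 := by
  have key : ∀ (s : Γ) (_ : s ∉ groupNorm Γ) (hs2 : s ^ 2 ∈ groupNorm Γ)
      (w : groupNorm Γ) (_ : s⁻¹ * y * s = y * w), l ⟨s ^ 2, hs2⟩ = 1 → l w = 1 := by
    intro s hs hs2 w hw h1
    obtain ⟨j, hj⟩ := conj_eq_mul_zpow (s := s) hy
    have hwj : (w : Γ) = s ^ j := mul_left_cancel (hw.symm.trans hj)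
    obtain ⟨k, hk⟩ := prime_dvd_of_zpow_mem Nat.prime_two hs hs2 (hwj ▸ w.2)
    have : w = ⟨s ^ 2, hs2⟩ ^ k := by
      apply Subtype.ext
      rw [hwj, hk, zpow_mul, Subgroup.coe_zpow]; norm_cast
    rw [this, map_zpow, h1, one_zpow]
  by_contra hlw
  have h1 : l ⟨s ^ 2, hs2⟩ ≠ 1 := fun h => hlw (key s hs hs2 w hw h)
  have hN : (groupNorm Γ).Normal := inferInstance
  have hsy2 : (s * y) ^ 2 = s ^ 2 * (y * w * y) := by
    rw [← hw, pow_two, pow_two]; group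
  have hmem : s ^ 2 * (y * w * y) ∈ groupNorm Γ :=
    mul_mem hs2 (mul_mem (mul_mem hy w.2) hy)
  refine hlw ?_
  have h2 := key (s * y) (fun h => hs (by simpa using mul_mem h (inv_mem hy))) (hsy2 ▸ hmem)
    (⟨y, hy⟩⁻¹ * w * ⟨y, hy⟩) (by
      have : (s * y)⁻¹ * y * (s * y) = y⁻¹ * (s⁻¹ * y * s) * y := by group
      rw [this, hw]; simp [mul_assoc]) ?_
  · rwa [map_mul, map_mul, map_inv, mul_comm, mul_inv_cancel_left] at h2
  · have e : (⟨(s * y) ^ 2, hsy2 ▸ hmem⟩ : groupNorm Γ) =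
        ⟨s ^ 2, hs2⟩ * (⟨y, hy⟩ * w * ⟨y, hy⟩) := Subtype.ext hsy2
    have hy2 : l ⟨y, hy⟩ * l ⟨y, hy⟩ = 1 := by
      rw [← pow_two, ← hA]; exact pow_card_eq_one'
    rw [e, map_mul, map_mul, map_mul, mul_right_comm (l ⟨y, hy⟩), hy2, one_mul]
    exact mul_eq_one_of_card_two hA h1 hlw

/-- Write `s⁻¹ * y * s = y * w`. Then `w` is a power of `s`, so the product is
`l y ^ p * l w ^ (0 + 1 + ⋯ + (p - 1))`, and for odd `p` both exponents are divisible by `p`. -/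
theorem prod_conj_groupNorm_eq_one {p : ℕ} (hp : p.Prime) {Γ A : Type*} [Group Γ]
    [CommGroup A] (hA : Nat.card A = p) (l : groupNorm Γ →* A) {s y : Γ}
    (hs : s ∉ groupNorm Γ) (hsp : s ^ p ∈ groupNorm Γ) (hy : y ∈ groupNorm Γ) :
    ∏ i ∈ Finset.range p,
      l ⟨(s ^ i)⁻¹ * y * s ^ i, (groupNorm_normal Γ).conj_mem' y hy (s ^ i)⟩ = 1 := by
  obtain ⟨j, hj⟩ := conj_eq_mul_zpow (s := s) hy
  have hw : s ^ j ∈ groupNorm Γ := by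
    rw [← inv_mul_eq_iff_eq_mul.mpr hj]
    exact mul_mem (inv_mem hy) ((groupNorm_normal Γ).conj_mem' y hy s)
  have hpA : ∀ a : A, a ^ p = 1 := fun a => by rw [← hA]; exact pow_card_eq_one'
  have hi : ∀ i : ℕ, (s ^ i)⁻¹ * y * s ^ i = y * (s ^ j) ^ i := by
    intro i
    induction i with
    | zero => simp
    | succ i ih =>
      have : (s ^ (i + 1))⁻¹ * y * s ^ (i + 1) = s⁻¹ * ((s ^ i)⁻¹ * y * s ^ i) * s := by
        rw [pow_succ]; group
      have hc : Commute s ((s ^ j) ^ i) := ((Commute.refl s).zpow_right j).pow_right i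
      rw [this, ih]
      calc s⁻¹ * (y * (s ^ j) ^ i) * s = (s⁻¹ * y * s) * (s⁻¹ * ((s ^ j) ^ i * s)) := by group
        _ = y * s ^ j * (s ^ j) ^ i := by rw [hj, ← hc.eq, inv_mul_cancel_left]
        _ = y * (s ^ j) ^ (i + 1) := by rw [mul_assoc, ← pow_succ']
  have hl : ∀ i : ℕ, l ⟨(s ^ i)⁻¹ * y * s ^ i, (groupNorm_normal Γ).conj_mem' y hy (s ^ i)⟩ =
      l ⟨y, hy⟩ * l ⟨s ^ j, hw⟩ ^ i := by
    intro i
    rw [← map_pow, ← map_mul]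
    exact congrArg l (Subtype.ext (hi i))
  simp only [hl]
  rw [Finset.prod_mul_distrib, Finset.prod_const, Finset.card_range, hpA, one_mul,
    Finset.prod_pow_eq_pow_sum]
  rcases hp.eq_two_or_odd' with rfl | hodd
  · have : l ⟨s ^ j, hw⟩ = 1 := apply_eq_one_of_sq_mem hA l hs hsp hy ⟨s ^ j, hw⟩ hj
    rw [this, one_pow]
  · have h2 : p ∣ ∑ i ∈ Finset.range p, i := by
      rw [Finset.sum_range_id, Nat.mul_div_assoc]
      · exact dvd_mul_right _ _
      · obtain ⟨k, hk⟩ := hodd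
        exact ⟨k, by omega⟩
    obtain ⟨k, hk⟩ := h2
    rw [hk, pow_mul, hpA, one_pow]

/-! ### Conjugation and the norm of a Sylow subgroup -/

open scoped Pointwise

variable {p : ℕ} {G : Type*} [Group G]

theorem mem_conj_smul {g x : G} {H : Subgroup G} :
    x ∈ MulAut.conj g • H ↔ g⁻¹ * x * g ∈ H := by
  rw [Subgroup.mem_pointwise_smul_iff_inv_smul_mem, ← map_inv, MulAut.smul_def, MulAut.conj_apply,
    inv_inv]

theorem mem_smul_sylow {g x : G} {P : Sylow p G} :
    x ∈ ((g • P : Sylow p G) : Subgroup G) ↔ g⁻¹ * x * g ∈ (P : Subgroup G) := by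
  rw [Sylow.coe_subgroup_smul, mem_conj_smul]

theorem mem_normalizer_conj_smul {g x : G} {H : Subgroup G} :
    x ∈ Subgroup.normalizer ((MulAut.conj g • H : Subgroup G) : Set G) ↔
      g⁻¹ * x * g ∈ Subgroup.normalizer (H : Set G) := by
  simp only [Subgroup.mem_normalizer_iff, mem_conj_smul]
  constructor
  · intro h y
    have := h (g * y * g⁻¹)
    simpa [mul_assoc] using this
  · intro h y
    have := h (g⁻¹ * y * g)
    simpa [mul_assoc] using this

theorem card_conj_smul (g : G) (H : Subgroup G) :
    Nat.card (MulAut.conj g • H : Subgroup G) = Nat.card H :=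
  (Nat.card_congr (Subgroup.equivSMul (MulAut.conj g) H).toEquiv).symm

/-- The norm of a subgroup `P`, viewed inside the ambient group, described without subtypes. -/
theorem mem_map_groupNorm {P : Subgroup G} {z : G} :
    z ∈ (groupNorm P).map P.subtype ↔
      z ∈ P ∧ ∀ H : Subgroup G, H ≤ P → z ∈ Subgroup.normalizer (H : Set G) := by
  constructor
  · rintro ⟨z, hz, rfl⟩
    refine ⟨z.2, fun H hH => ?_⟩
    have h := Subgroup.mem_normalizer_iff.mp (norm_mem_normalizer hz (H.subgroupOf P))
    refine Subgroup.mem_normalizer_iff.mpr fun x => ⟨fun hx => ?_, fun hx => ?_⟩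
    · exact (h ⟨x, hH hx⟩).mp hx
    · have hxP : x ∈ P := by
        have := mul_mem (mul_mem (inv_mem z.2) (hH hx)) z.2
        simpa [mul_assoc] using this
      exact (h ⟨x, hxP⟩).mpr hx
  · rintro ⟨hzP, hz⟩
    refine ⟨⟨z, hzP⟩, Subgroup.mem_iInf.mpr fun H => ?_, rfl⟩
    have h := Subgroup.mem_normalizer_iff.mp (hz (H.map P.subtype) (Subgroup.map_subtype_le H))
    refine Subgroup.mem_normalizer_iff.mpr fun x => ?_
    have e : z * x * z⁻¹ ∈ H.map P.subtype ↔ (⟨z, hzP⟩ * x * ⟨z, hzP⟩⁻¹ : P) ∈ H :=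
      Subgroup.mem_map_iff_mem P.subtype_injective (x := (⟨z, hzP⟩ * x * ⟨z, hzP⟩⁻¹ : P))
    rw [← e, ← h x]
    exact (Subgroup.mem_map_iff_mem P.subtype_injective).symm

theorem conj_mem_map_groupNorm {P : Subgroup G} {n z : G}
    (hn : n ∈ Subgroup.normalizer (P : Set G)) (hz : z ∈ (groupNorm P).map P.subtype) :
    n * z * n⁻¹ ∈ (groupNorm P).map P.subtype := by
  rw [mem_map_groupNorm] at hz ⊢
  refine ⟨(Subgroup.mem_normalizer_iff.mp hn z).mp hz.1, fun H hH => ?_⟩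
  have h := hz.2 (MulAut.conj n⁻¹ • H) (fun x hx => by
    rw [mem_conj_smul] at hx
    exact (Subgroup.mem_normalizer_iff.mp hn x).mpr (by simpa using hH hx))
  rw [mem_normalizer_conj_smul, inv_inv] at h
  exact h

theorem exists_mem_normalizer_notMem [Fact p.Prime] {R Q : Subgroup G} [Finite Q]
    (hQ : IsPGroup p Q) (hRQ : R < Q) :
    ∃ v ∈ Q, v ∈ Subgroup.normalizer (R : Set G) ∧ v ∉ R := by
  have := hQ.isNilpotent
  have h := Group.normalizerCondition_of_isNilpotent (G := Q) (R.subgroupOf Q) (by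
    rw [lt_top_iff_ne_top, Ne, Subgroup.subgroupOf_eq_top]; exact not_le_of_gt hRQ)
  obtain ⟨v, hv, hv'⟩ := SetLike.exists_of_lt h
  refine ⟨v, v.2, ?_, hv'⟩
  rw [← Subgroup.subgroupOf_normalizer_eq hRQ.le] at hv
  exact hv

/-! ### Sylow subgroups of normalizers -/

/-- `N_T(R)` is a Sylow `p`-subgroup of `N_G(R)`. The subgroup `R` is not required to lie in `T`. -/
def IsFullyNormalized (T : Sylow p G) (R : Subgroup G) : Prop :=
  ∃ S : Sylow p (Subgroup.normalizer (R : Set G)),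
    (S : Subgroup (Subgroup.normalizer (R : Set G))) =
      (T : Subgroup G).subgroupOf (Subgroup.normalizer (R : Set G))

/-- A description in terms of subgroups of `G` only, so that it can be transported along a
conjugation, which changes the group `N_G(R)`. -/
theorem isFullyNormalized_iff {T : Sylow p G} {R : Subgroup G} :
    IsFullyNormalized T R ↔ ∀ U : Subgroup G, IsPGroup p U →
      U ≤ Subgroup.normalizer (R : Set G) →
      (T : Subgroup G) ⊓ Subgroup.normalizer (R : Set G) ≤ U → U ≤ T := by
  constructor
  · rintro ⟨S, hS⟩ U hU hUN hTU
    have h1 := S.is_maximal' (Q := U.subgroupOf _)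
      (hU.comap_of_injective _ (Subgroup.subtype_injective _)) (by
        rw [hS]; intro x hx; exact hTU ⟨hx, x.2⟩)
    rw [hS] at h1
    intro x hx
    have : (⟨x, hUN hx⟩ : Subgroup.normalizer (R : Set G)) ∈
      U.subgroupOf (Subgroup.normalizer (R : Set G)) := hx
    rw [h1] at this
    exact this
  · intro h
    refine ⟨⟨(T : Subgroup G).subgroupOf _,
      T.isPGroup'.comap_of_injective _ (Subgroup.subtype_injective _), ?_⟩, rfl⟩
    intro Q hQ hTQ
    refine le_antisymm (fun x hx => ?_) hTQ
    refine h (Q.map (Subgroup.subtype _)) (hQ.map _) (Subgroup.map_subtype_le Q) ?_ ⟨x, hx, rfl⟩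
    rintro y ⟨hyT, hyN⟩
    exact ⟨⟨y, hyN⟩, hTQ hyT, rfl⟩

theorem IsFullyNormalized.smul {T : Sylow p G} {R : Subgroup G} (h : IsFullyNormalized T R)
    (g : G) : IsFullyNormalized (g • T) (MulAut.conj g • R) := by
  rw [isFullyNormalized_iff] at h ⊢
  intro U hU hUN hTU x hx
  have := h (MulAut.conj g⁻¹ • U) (hU.of_equiv (Subgroup.equivSMul (MulAut.conj g⁻¹) U))
    (fun y hy => by
      rw [mem_conj_smul] at hy
      have := mem_normalizer_conj_smul.mp (hUN hy)
      simpa [mul_assoc] using this)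
    (fun y hy => by
      rw [mem_conj_smul]
      refine hTU (Subgroup.mem_inf.mpr ⟨?_, ?_⟩)
      · rw [mem_smul_sylow]
        have e : g⁻¹ * (g⁻¹⁻¹ * y * g⁻¹) * g = y := by group
        rw [e]
        exact hy.1
      · rw [mem_normalizer_conj_smul]
        simpa [mul_assoc] using hy.2)
  rw [mem_smul_sylow]
  exact this (mem_conj_smul.mpr (by simpa [mul_assoc] using hx))

theorem exists_isFullyNormalized {R U : Subgroup G} (hU : IsPGroup p U)
    (hUN : U ≤ Subgroup.normalizer (R : Set G)) :
    ∃ T : Sylow p G, U ≤ T ∧ IsFullyNormalized T R := by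
  obtain ⟨S, hS⟩ := (hU.comap_of_injective (Subgroup.subtype (Subgroup.normalizer (R : Set G)))
    (Subgroup.subtype_injective _)).exists_le_sylow
  obtain ⟨T, hT⟩ := S.exists_comap_subtype_eq
  refine ⟨T, fun x hx => ?_, S, hT.symm⟩
  have : (⟨x, hUN hx⟩ : Subgroup.normalizer (R : Set G)) ∈ S := hS hx
  rw [← SetLike.mem_coe, ← Sylow.coe_coe, ← hT] at this
  exact this

/-- Sylow's theorem in `N_G(R)`. -/
theorem exists_conj_of_isFullyNormalized [Fact p.Prime] [Finite G] {T T' : Sylow p G}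
    {R : Subgroup G} (h : IsFullyNormalized T R) (h' : IsFullyNormalized T' R) :
    ∃ c ∈ Subgroup.normalizer (R : Set G), ∀ x ∈ Subgroup.normalizer (R : Set G),
      x ∈ (T' : Subgroup G) ↔ c * x * c⁻¹ ∈ (T : Subgroup G) := by
  obtain ⟨S, hS⟩ := h
  obtain ⟨S', hS'⟩ := h'
  obtain ⟨c, hc⟩ := MulAction.exists_smul_eq (Subgroup.normalizer (R : Set G)) S' S
  refine ⟨c, c.2, fun x hx => ?_⟩
  have e1 : x ∈ (T' : Subgroup G) ↔ (⟨x, hx⟩ : Subgroup.normalizer (R : Set G)) ∈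
    (S' : Subgroup (Subgroup.normalizer (R : Set G))) := by rw [hS']; rfl
  have e2 : c * x * (c : G)⁻¹ ∈ (T : Subgroup G) ↔ c * (⟨x, hx⟩) * c⁻¹ ∈
    (S : Subgroup (Subgroup.normalizer (R : Set G))) := by rw [hS]; rfl
  rw [e1, e2, ← hc, mem_smul_sylow]
  simp [mul_assoc]

/-- A `p`-nilpotent group is the product of a Sylow `p`-subgroup and a normal `p'`-subgroup, and the
latter centralizes every normal `p`-subgroup. -/
theorem IsPNilpotent.exists_mul_centralizing [Fact p.Prime] [Finite G] (h : IsPNilpotent p G)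
    (S : Sylow p G) {R : Subgroup G} (hR : R.Normal) (hRp : IsPGroup p R) (c : G) :
    ∃ s ∈ S, ∃ k : G, c = s * k ∧ ∀ y ∈ R, k * y = y * k := by
  obtain ⟨K, hK, hKp, n, hn⟩ := h
  have htop : (S : Subgroup G) ⊔ K = ⊤ := by
    rw [← Subgroup.index_eq_one]
    have h1 : ((S : Subgroup G) ⊔ K).index ∣ p ^ n := hn ▸ Subgroup.index_dvd_of_le le_sup_right
    have h2 : ((S : Subgroup G) ⊔ K).index ∣ (S : Subgroup G).index :=
      Subgroup.index_dvd_of_le le_sup_left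
    obtain ⟨m, -, hm⟩ := (Nat.dvd_prime_pow Fact.out).mp h1
    rcases m with _ | m
    · simpa using hm
    · exact absurd ((dvd_pow_self p (Nat.succ_ne_zero m)).trans (hm ▸ h2)) S.not_dvd_index
  have hc : c ∈ (S : Subgroup G) ⊔ K := htop ▸ Subgroup.mem_top c
  obtain ⟨s, hs, k, hk, rfl⟩ := Subgroup.mem_sup_of_normal_right.mp hc
  refine ⟨s, hs, k, rfl, fun y hy => ?_⟩
  refine Subgroup.commute_of_normal_of_disjoint K R hK hR ?_ k y hk hy
  obtain ⟨m, hm⟩ := hRp.exists_card_eq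
  refine Subgroup.disjoint_of_coprime_natCard ?_
  rw [hm]
  exact hKp.symm.pow_right m

/-! ### Fusion above the norm -/

/-- Conjugation by `g` agrees on `R` with conjugation by some element of `N_G(P)`. -/
def ActsAsNormalizer (P : Sylow p G) (R : Subgroup G) (g : G) : Prop :=
  ∃ n ∈ Subgroup.normalizer ((P : Subgroup G) : Set G), ∀ y ∈ R, g * y * g⁻¹ = n * y * n⁻¹

theorem ActsAsNormalizer.mono {P : Sylow p G} {R R' : Subgroup G} {g : G}
    (h : ActsAsNormalizer P R' g) (hR : R ≤ R') : ActsAsNormalizer P R g :=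
  let ⟨n, hn, hy⟩ := h
  ⟨n, hn, fun y hyR => hy y (hR hyR)⟩

theorem ActsAsNormalizer.mul {P : Sylow p G} {R R' : Subgroup G} {a b : G}
    (ha : ActsAsNormalizer P R' a) (hb : ActsAsNormalizer P R b)
    (hR : ∀ y ∈ R, b * y * b⁻¹ ∈ R') : ActsAsNormalizer P R (a * b) := by
  obtain ⟨n, hn, hna⟩ := ha
  obtain ⟨m, hm, hmb⟩ := hb
  refine ⟨n * m, mul_mem hn hm, fun y hy => ?_⟩
  have h1 := hna _ (hR y hy)
  calc a * b * y * (a * b)⁻¹ = a * (b * y * b⁻¹) * a⁻¹ := by group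
    _ = n * (b * y * b⁻¹) * n⁻¹ := h1
    _ = n * (m * y * m⁻¹) * n⁻¹ := by rw [hmb y hy]
    _ = n * m * y * (n * m)⁻¹ := by group

theorem actsAsNormalizer_of_isPNilpotent [Fact p.Prime] [Finite G] {P : Sylow p G}
    {R : Subgroup G} (hRP : R ≤ P) (hfn : IsFullyNormalized P R)
    (hnil : IsPNilpotent p (Subgroup.normalizer (R : Set G))) {c : G}
    (hc : c ∈ Subgroup.normalizer (R : Set G)) : ActsAsNormalizer P R c := by
  obtain ⟨S, hS⟩ := hfn
  have hRp : IsPGroup p (R.subgroupOf (Subgroup.normalizer (R : Set G))) :=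
    (P.isPGroup'.to_le hRP).comap_of_injective _ (Subgroup.subtype_injective _)
  obtain ⟨s, hs, k, hck, hk⟩ := hnil.exists_mul_centralizing S
    (R := R.subgroupOf (Subgroup.normalizer (R : Set G))) inferInstance hRp ⟨c, hc⟩
  have hsP : (s : G) ∈ (P : Subgroup G) := by
    have : s ∈ (S : Subgroup (Subgroup.normalizer (R : Set G))) := hs
    rw [hS] at this
    exact this
  refine ⟨s, Subgroup.le_normalizer hsP, fun y hy => ?_⟩
  have hky : (k : G) * y = y * k :=
    congrArg Subtype.val (hk ⟨y, Subgroup.le_normalizer hy⟩ hy)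
  have hck' : c = s * k := congrArg Subtype.val hck
  rw [hck', mul_inv_rev, mul_assoc (s : G), hky]
  group

/-- The inductive step of the fusion theorem, for an intersection `R = P ∩ Q` of `P` with
`Q = g⁻¹ P g`, when `N_P(R)` is Sylow in `N_G(R)`. Sylow's theorem in `N_G(R)` gives `c ∈ N_G(R)`
such that `S = c⁻¹ P c` contains `N_Q(R)`. If `P ∩ S = R`, this intersection is tame and the
`p`-nilpotence of `N_G(R)` handles `c`; otherwise induction applies to `c` on `P ∩ S`. Finally
`g c⁻¹` carries `c (Q ∩ S) c⁻¹`, which is larger than `R`, into `P`, so induction applies to it. -/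
theorem actsAsNormalizer_of_isFullyNormalized [Fact p.Prime] [Finite G] {P : Sylow p G}
    {Z : Subgroup G}
    (h : ∀ Q : Sylow p G, IsTameIntersection P Q → Z < (P : Subgroup G) ⊓ (Q : Subgroup G) →
      (P : Subgroup G) ⊓ (Q : Subgroup G) < (P : Subgroup G) →
      IsPNilpotent p
        (Subgroup.normalizer (((P : Subgroup G) ⊓ (Q : Subgroup G) : Subgroup G) : Set G)))
    {R : Subgroup G}
    (ih : ∀ R' : Subgroup G, R' ≤ P → Nat.card R < Nat.card R' → Z < R' → ∀ g : G,
      (∀ y ∈ R', g * y * g⁻¹ ∈ (P : Subgroup G)) → ActsAsNormalizer P R' g)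
    (hfn : IsFullyNormalized P R) (hZ : Z < R) (hRP : R < P) {g : G}
    (hg : R = (P : Subgroup G) ⊓ ((g⁻¹ • P : Sylow p G) : Subgroup G)) :
    ActsAsNormalizer P R g := by
  have hRQ : R < ((g⁻¹ • P : Sylow p G) : Subgroup G) := by
    refine lt_of_le_of_ne (hg ▸ inf_le_right) fun e => hRP.ne ?_
    refine Subgroup.eq_of_le_of_card_ge hRP.le ?_
    rw [e, Sylow.coe_subgroup_smul, card_conj_smul]
  obtain ⟨v, hvQ, hvN, hvR⟩ := exists_mem_normalizer_notMem (g⁻¹ • P).isPGroup' hRQ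
  obtain ⟨T, hUT, hT⟩ := exists_isFullyNormalized (R := R)
    (U := ((g⁻¹ • P : Sylow p G) : Subgroup G) ⊓ Subgroup.normalizer (R : Set G))
    ((g⁻¹ • P).isPGroup'.to_le inf_le_left) inf_le_right
  obtain ⟨c, hcN, hc⟩ := exists_conj_of_isFullyNormalized hfn hT
  have hcR := Subgroup.mem_normalizer_iff.mp hcN
  have hSmem : ∀ x, x ∈ ((c⁻¹ • P : Sylow p G) : Subgroup G) ↔ c * x * c⁻¹ ∈ (P : Subgroup G) :=
    fun x => by rw [mem_smul_sylow, inv_inv]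
  have hST : ((c⁻¹ • P : Sylow p G) : Subgroup G).subgroupOf (Subgroup.normalizer (R : Set G)) =
      (T : Subgroup G).subgroupOf (Subgroup.normalizer (R : Set G)) := by
    ext x
    rw [Subgroup.mem_subgroupOf, Subgroup.mem_subgroupOf, hSmem, hc x x.2]
  have hRS : R ≤ (P : Subgroup G) ⊓ ((c⁻¹ • P : Sylow p G) : Subgroup G) :=
    le_inf hRP.le fun x hx => (hSmem x).mpr (hRP.le ((hcR x).mp hx))
  have hcact : ActsAsNormalizer P R c := by
    rcases hRS.eq_or_lt with e | hlt
    · refine actsAsNormalizer_of_isPNilpotent hRP.le hfn ?_ hcN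
      have htame : IsTameIntersection P (c⁻¹ • P) := by
        unfold IsTameIntersection
        rw [← e]
        refine ⟨hfn, ?_⟩
        obtain ⟨S, hS⟩ := hT
        exact ⟨S, hS.trans hST.symm⟩
      have := h (c⁻¹ • P) htame (e ▸ hZ) (e ▸ hRP)
      rwa [← e] at this
    · refine (ih _ inf_le_left ?_ (hZ.trans hlt) c fun y hy => (hSmem y).mp hy.2).mono hRS
      exact Set.Finite.card_lt_card (Set.toFinite _) hlt
  have hvS : v ∈ ((c⁻¹ • P : Sylow p G) : Subgroup G) := by
    have h1 : (⟨v, hvN⟩ : Subgroup.normalizer (R : Set G)) ∈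
      (T : Subgroup G).subgroupOf (Subgroup.normalizer (R : Set G)) := hUT ⟨hvQ, hvN⟩
    rw [← hST] at h1
    exact h1
  let U : Subgroup G := MulAut.conj c •
    (((g⁻¹ • P : Sylow p G) : Subgroup G) ⊓ ((c⁻¹ • P : Sylow p G) : Subgroup G))
  have hUmem : ∀ x, x ∈ U ↔ c⁻¹ * x * c ∈
    (((g⁻¹ • P : Sylow p G) : Subgroup G) ⊓ ((c⁻¹ • P : Sylow p G) : Subgroup G)) :=
    fun x => mem_conj_smul
  have hUP : U ≤ P := fun x hx => by
    have := (hSmem _).mp ((hUmem x).mp hx).2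
    simpa [mul_assoc] using this
  have hRU : R < U := by
    refine lt_of_le_of_ne (fun x hx => (hUmem x).mpr ?_) fun e => hvR ?_
    · have := (hcR (c⁻¹ * x * c)).mpr (by simpa [mul_assoc] using hx)
      exact ⟨hRQ.le this, (hRS this).2⟩
    · rw [hcR, e, hUmem]
      have : c⁻¹ * (c * v * c⁻¹) * c = v := by group
      rw [this]
      exact ⟨hvQ, hvS⟩
  have hgc : ActsAsNormalizer P U (g * c⁻¹) := by
    refine ih U hUP (Set.Finite.card_lt_card (Set.toFinite _) hRU) (hZ.trans hRU) _ fun y hy => ?_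
    have := ((hUmem y).mp hy).1
    have h1 := mem_smul_sylow.mp this
    simpa [mul_assoc] using h1
  have := hgc.mul hcact fun y hy => hRU.le ((hcR y).mp hy)
  simpa using this

/-- Fusion above `Z` is controlled by `N_G(P)`. By downward induction on `|R|`, one may assume that
`R = P ∩ g⁻¹ P g` is proper in `P`. A conjugation making `N_P(R)` Sylow in `N_G(R)` maps a subgroup
of `P` larger than `R` into `P`, so by induction it agrees on `R` with an element of `N_G(P)`; this
ensures that the conjugate of `R` still contains `Z`. -/
theorem actsAsNormalizer_of_lt [Fact p.Prime] [Finite G] {P : Sylow p G}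
    {Z : Subgroup G}
    (hZN : ∀ n ∈ Subgroup.normalizer ((P : Subgroup G) : Set G), ∀ z ∈ Z, n * z * n⁻¹ ∈ Z)
    (h : ∀ Q : Sylow p G, IsTameIntersection P Q → Z < (P : Subgroup G) ⊓ (Q : Subgroup G) →
      (P : Subgroup G) ⊓ (Q : Subgroup G) < (P : Subgroup G) →
      IsPNilpotent p
        (Subgroup.normalizer (((P : Subgroup G) ⊓ (Q : Subgroup G) : Subgroup G) : Set G)))
    (R : Subgroup G) (hRP : R ≤ P) (hZ : Z < R) (g : G)
    (hg : ∀ y ∈ R, g * y * g⁻¹ ∈ (P : Subgroup G)) : ActsAsNormalizer P R g := by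
  induction hk : Nat.card P - Nat.card R using Nat.strong_induction_on generalizing R g with
  | _ k ih' =>
  have ih : ∀ R' : Subgroup G, R' ≤ P → Nat.card R < Nat.card R' → Z < R' → ∀ g : G,
      (∀ y ∈ R', g * y * g⁻¹ ∈ (P : Subgroup G)) → ActsAsNormalizer P R' g := by
    intro R' hR'P hlt hZR' g hg
    have := Subgroup.card_le_of_le hR'P
    exact ih' _ (by omega) R' hR'P hZR' g hg rfl
  have hRD : R ≤ (P : Subgroup G) ⊓ ((g⁻¹ • P : Sylow p G) : Subgroup G) :=
    le_inf hRP fun y hy => by rw [mem_smul_sylow, inv_inv]; exact hg y hy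
  rcases hRD.eq_or_lt with e | hlt
  swap
  · refine (ih _ inf_le_left (Set.Finite.card_lt_card (Set.toFinite _) hlt) (hZ.trans hlt) g
      fun y hy => ?_).mono hRD
    have := hy.2
    have h1 := mem_smul_sylow.mp this
    rwa [inv_inv] at h1
  rcases hRP.eq_or_lt with rfl | hRP'
  · refine ⟨g, ?_, fun _ _ => rfl⟩
    rw [Subgroup.mem_normalizer_iff]
    intro y
    have h2 : ((P : Subgroup G)) = ((g⁻¹ • P : Sylow p G) : Subgroup G) :=
      Subgroup.eq_of_le_of_card_ge (le_of_eq_of_le e inf_le_right)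
        (by rw [Sylow.coe_subgroup_smul, card_conj_smul])
    conv_lhs => rw [h2, mem_smul_sylow, inv_inv]
  obtain ⟨v, hvP, hvN, hvR⟩ := exists_mem_normalizer_notMem P.isPGroup' hRP'
  obtain ⟨T, hUT, hT⟩ := exists_isFullyNormalized (R := R)
    (U := (P : Subgroup G) ⊓ Subgroup.normalizer (R : Set G))
    (P.isPGroup'.to_le inf_le_left) inf_le_right
  obtain ⟨t, rfl⟩ := MulAction.exists_smul_eq G P T
  have hRT : R < (P : Subgroup G) ⊓ ((t • P : Sylow p G) : Subgroup G) := by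
    refine lt_of_le_of_ne (le_inf hRP fun x hx => hUT ⟨hRP hx, Subgroup.le_normalizer hx⟩)
      fun e => hvR ?_
    rw [e]
    exact ⟨hvP, hUT ⟨hvP, hvN⟩⟩
  obtain ⟨n, hn, hnt⟩ : ActsAsNormalizer P R t⁻¹ := by
    refine (ih _ inf_le_left (Set.Finite.card_lt_card (Set.toFinite _) hRT) (hZ.trans hRT) _
      fun y hy => ?_).mono hRT.le
    have := mem_smul_sylow.mp hy.2
    rwa [inv_inv]
  have hnP : n⁻¹⁻¹ ∈ Subgroup.normalizer ((P : Subgroup G) : Set G) := by rwa [inv_inv]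
  have hconj : MulAut.conj t⁻¹ • R = MulAut.conj n • R := by
    refine Subgroup.eq_of_le_of_card_ge (fun x hx => ?_) (by rw [card_conj_smul, card_conj_smul])
    rw [mem_conj_smul] at hx ⊢
    have h1 := hnt _ hx
    have h2 : x = n * (t⁻¹⁻¹ * x * t⁻¹) * n⁻¹ := by rw [← h1]; group
    rw [h2]
    simpa [mul_assoc] using hx
  have hfn : IsFullyNormalized P (MulAut.conj n • R) := by
    have := hT.smul t⁻¹
    rwa [inv_smul_smul, hconj] at this
  have hZ' : Z < MulAut.conj n • R := by
    refine lt_of_le_of_ne (fun z hz => mem_conj_smul.mpr (hZ.le ?_)) fun e => ?_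
    · have := hZN n⁻¹ (inv_mem hn) z hz
      rwa [inv_inv] at this
    · have h1 : Nat.card Z < Nat.card R := Set.Finite.card_lt_card (Set.toFinite _) hZ
      rw [e, card_conj_smul] at h1
      exact lt_irrefl _ h1
  have hnPmem : ∀ x, n⁻¹ * x * n ∈ (P : Subgroup G) ↔ x ∈ (P : Subgroup G) := fun x =>
    (Subgroup.mem_normalizer_iff''.mp hn x).symm
  have hRnP : MulAut.conj n • R ≤ P := fun x hx =>
    (hnPmem x).mp (hRP (mem_conj_smul.mp hx))
  have hRnP' : MulAut.conj n • R < (P : Subgroup G) := by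
    refine lt_of_le_of_ne hRnP fun e' => ?_
    have h1 : Nat.card R < Nat.card P := Set.Finite.card_lt_card (Set.toFinite _) hRP'
    rw [← card_conj_smul n R, e'] at h1
    exact lt_irrefl _ h1
  have hgn : ActsAsNormalizer P (MulAut.conj n • R) (g * n⁻¹) := by
    refine actsAsNormalizer_of_isFullyNormalized h ?_ hfn hZ' hRnP' ?_
    · rwa [card_conj_smul]
    · ext x
      rw [mem_conj_smul, e, Subgroup.mem_inf, Subgroup.mem_inf, hnPmem, mem_smul_sylow,
        mem_smul_sylow]
      simp [mul_assoc]
  have := hgn.mul (R := R) (b := n) ⟨n, hn, fun _ _ => rfl⟩ fun y hy =>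
    mem_conj_smul.mpr (by simpa [mul_assoc] using hy)
  simpa using this

/-! ### The transfer as a product over fixed cosets -/

open Classical in
/-- The extension of `φ` to a function on all of `G` with value `1` outside `H`. -/
noncomputable def extendByOne {A : Type*} [Group A] {H : Subgroup G} (φ : H →* A) (y : G) : A :=
  if h : y ∈ H then φ ⟨y, h⟩ else 1

section extendByOne

variable {A : Type*} [CommGroup A] {H : Subgroup G} (φ : H →* A)

theorem extendByOne_of_mem {y : G} (h : y ∈ H) : extendByOne φ y = φ ⟨y, h⟩ := dif_pos h

theorem extendByOne_of_notMem {y : G} (h : y ∉ H) : extendByOne φ y = 1 := dif_neg h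

theorem extendByOne_conj {n : G} (hn : n ∈ H) (y : G) :
    extendByOne φ (n⁻¹ * y * n) = extendByOne φ y := by
  have hiff : n⁻¹ * y * n ∈ H ↔ y ∈ H := by
    rw [H.mul_mem_cancel_right hn, H.mul_mem_cancel_left (inv_mem hn)]
  by_cases hy : y ∈ H
  · rw [extendByOne_of_mem φ hy, extendByOne_of_mem φ (hiff.mpr hy)]
    have : (⟨n⁻¹ * y * n, hiff.mpr hy⟩ : H) = ⟨n, hn⟩⁻¹ * ⟨y, hy⟩ * ⟨n, hn⟩ := rfl
    rw [this, map_mul, map_mul, map_inv, mul_comm, mul_inv_cancel_left]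
  · rw [extendByOne_of_notMem φ hy, extendByOne_of_notMem φ (mt hiff.mp hy)]

theorem extendByOne_out_conj (x g : G) :
    extendByOne φ ((g : G ⧸ H).out⁻¹ * x * (g : G ⧸ H).out) = extendByOne φ (g⁻¹ * x * g) := by
  obtain ⟨h, hh⟩ := QuotientGroup.mk_out_eq_mul H g
  rw [hh, ← extendByOne_conj φ h.2 (g⁻¹ * x * g)]
  congr 1
  group

theorem out_conj_mem_iff (x : G) (c : G ⧸ H) : c.out⁻¹ * x * c.out ∈ H ↔ x • c = c := by
  induction c using QuotientGroup.induction_on with | H g =>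
  obtain ⟨h, hh⟩ := QuotientGroup.mk_out_eq_mul H g
  rw [eq_comm, MulAction.Quotient.smul_coe, QuotientGroup.eq, hh, smul_eq_mul]
  have : (g * h : G)⁻¹ * x * (g * h) = (h : G)⁻¹ * (g⁻¹ * (x * g)) * h := by group
  rw [this, H.mul_mem_cancel_right h.2, H.mul_mem_cancel_left (inv_mem h.2)]

/-- If the orbits of `x` of length at least two contribute nothing to the transfer of `x`, then the
transfer is the product over the cosets fixed by `x`; the other factors on the right are `1`, since
`c.out⁻¹ * x * c.out ∉ H` for them. -/
theorem transfer_eq_prod_extendByOne [Fintype (G ⧸ H)] [H.FiniteIndex] (x : G)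
    (hx : ∀ c : G ⧸ H, Function.minimalPeriod (x • ·) c ≠ 1 →
      extendByOne φ (c.out⁻¹ * x ^ Function.minimalPeriod (x • ·) c * c.out) = 1) :
    φ.transfer x = ∏ c : G ⧸ H, extendByOne φ (c.out⁻¹ * x * c.out) := by
  classical
  let S := MulAction.orbitRel (Subgroup.zpowers x) (G ⧸ H)
  have : Fintype (Quotient S) := Fintype.ofFinite _
  rw [MonoidHom.transfer_eq_prod_quotient_orbitRel_zpowers_quot,
    ← Finset.prod_fiberwise (s := Finset.univ) (g := fun c => (Quotient.mk S c))]
  refine Finset.prod_congr rfl fun q _ => ?_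
  rw [← extendByOne_of_mem φ]
  have hfixed : ∀ c : G ⧸ H, Quotient.mk S c = q → x • q.out = q.out → c = q.out := by
    intro c hc hq
    have h1 : S c q.out := by
      rw [← Quotient.eq (r := S), hc, Quotient.out_eq]
    obtain ⟨⟨_, k, rfl⟩, hk⟩ := MulAction.orbitRel_apply.mp h1
    rw [← hk]
    exact (MulAction.stabilizer G q.out).zpow_mem hq k
  by_cases hq : x • q.out = q.out
  · have h1 : Function.minimalPeriod (x • ·) q.out = 1 :=
      Function.minimalPeriod_eq_one_iff_isFixedPt.mpr hq
    rw [h1, pow_one, Finset.prod_eq_single_of_mem q.out]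
    · simp
    · intro c hc hne
      exact absurd (hfixed c (Finset.mem_filter.mp hc).2 hq) hne
  · rw [hx _ fun h => hq (Function.minimalPeriod_eq_one_iff_isFixedPt.mp h)]
    symm
    refine Finset.prod_eq_one fun c hc => extendByOne_of_notMem φ ?_
    rw [out_conj_mem_iff]
    intro hxc
    have h1 : S q.out c := by
      rw [← Quotient.eq (r := S), (Finset.mem_filter.mp hc).2, Quotient.out_eq]
    obtain ⟨⟨_, k, rfl⟩, hk⟩ := MulAction.orbitRel_apply.mp h1
    have h2 : x ^ k • c = c := (MulAction.stabilizer G c).zpow_mem hxc k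
    have : q.out = c := hk.symm.trans h2
    exact hq (this ▸ hxc)

end extendByOne

/-! ### Transfer into a group of order `p` -/

/-- `P` contains every `p`-element of its normalizer. -/
theorem mem_of_conj_mem_normalizer {P : Sylow p G} {g y : G} (hy : y ∈ (P : Subgroup G))
    (h : g⁻¹ * y * g ∈ Subgroup.normalizer ((P : Subgroup G) : Set G)) :
    g⁻¹ * y * g ∈ (P : Subgroup G) := by
  have hmem : g⁻¹ * y * g ∈ MulAut.conj g⁻¹ • (P : Subgroup G) :=
    mem_conj_smul.mpr (by simpa [mul_assoc] using hy)
  have hp : IsPGroup p (MulAut.conj g⁻¹ • (P : Subgroup G) : Subgroup G) :=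
    P.isPGroup'.of_equiv (Subgroup.equivSMul (MulAut.conj g⁻¹) (P : Subgroup G))
  have := hp.inf_normalizer_sylow P
  exact (this.le ⟨hmem, h⟩).2

/-- For `g ∉ N_G(P)`, with `D` the stabilizer in `P` of the coset of `g`, there is an element `s`
that makes the contribution of the `P`-orbit of this coset trivial. -/
theorem exists_prod_conj_eq_one [Fact p.Prime] [Finite G] {P : Sylow p G}
    (hfus : ∀ R : Subgroup G, R ≤ P →
      (groupNorm (P : Subgroup G)).map (P : Subgroup G).subtype < R → ∀ g : G,
      (∀ y ∈ R, g * y * g⁻¹ ∈ (P : Subgroup G)) → ActsAsNormalizer P R g)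
    {A : Type*} [CommGroup A] (hA : Nat.card A = p)
    (φ : Subgroup.normalizer ((P : Subgroup G) : Set G) →* A) {g : G}
    (hg : g ∉ Subgroup.normalizer ((P : Subgroup G) : Set G)) {D : Subgroup P}
    (hD : ∀ u : P, u ∈ D ↔ g⁻¹ * u * g ∈ Subgroup.normalizer ((P : Subgroup G) : Set G)) :
    ∃ s ∈ Subgroup.normalizer (D : Set P), s ∉ D ∧ s ^ p ∈ D ∧ ∀ y ∈ D,
      ∏ i ∈ Finset.range p, extendByOne φ (g⁻¹ * ((s ^ i)⁻¹ * y * s ^ i : P) * g) = 1 := by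
  have hp : p.Prime := Fact.out
  have hpA : ∀ a : A, a ^ p = 1 := fun a => by rw [← hA]; exact pow_card_eq_one'
  let l : D →* A := MonoidHom.mk' (fun y => φ ⟨g⁻¹ * y * g, (hD y).mp y.2⟩) fun a b => by
    rw [← map_mul]
    refine congrArg φ (Subtype.ext ?_)
    simp [mul_assoc]
  have hl : ∀ (y : P) (hy : y ∈ D), extendByOne φ (g⁻¹ * y * g) = l ⟨y, hy⟩ := fun y hy =>
    extendByOne_of_mem φ ((hD y).mp hy)
  have hDtop : ¬ (⊤ : Subgroup P) ≤ D := by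
    intro htop
    have : ∀ y ∈ (P : Subgroup G), g⁻¹ * y * g ∈ (P : Subgroup G) := fun y hy =>
      mem_of_conj_mem_normalizer hy ((hD ⟨y, hy⟩).mp (htop (Subgroup.mem_top _)))
    have hle : MulAut.conj g⁻¹ • (P : Subgroup G) = P :=
      Subgroup.eq_of_le_of_card_ge (fun x hx => by
        have := this _ (mem_conj_smul.mp hx)
        simpa [mul_assoc] using this) (card_conj_smul _ _).ge
    refine hg (Subgroup.mem_normalizer_iff''.mpr fun y => ?_)
    conv_rhs => rw [← SetLike.mem_coe, ← hle, SetLike.mem_coe, mem_conj_smul]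
    simp [mul_assoc]
  -- it is enough that `l` is invariant under `s`
  have hinv : ∀ s ∈ Subgroup.normalizer (D : Set P),
      (∀ y ∈ D, extendByOne φ (g⁻¹ * (s⁻¹ * y * s : P) * g) = extendByOne φ (g⁻¹ * y * g)) →
      ∀ y ∈ D, ∏ i ∈ Finset.range p,
        extendByOne φ (g⁻¹ * ((s ^ i)⁻¹ * y * s ^ i : P) * g) = 1 := by
    intro s hs h y hy
    have hi : ∀ i : ℕ, (s ^ i)⁻¹ * y * s ^ i ∈ D ∧
        extendByOne φ (g⁻¹ * ((s ^ i)⁻¹ * y * s ^ i : P) * g) = extendByOne φ (g⁻¹ * y * g) := by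
      intro i
      induction i with
      | zero => simpa using hy
      | succ i ih =>
        have e : (s ^ (i + 1))⁻¹ * y * s ^ (i + 1) = s⁻¹ * ((s ^ i)⁻¹ * y * s ^ i) * s := by
          rw [pow_succ]; group
        rw [e]
        exact ⟨(Subgroup.mem_normalizer_iff''.mp hs _).mp ih.1, (h _ ih.1).trans ih.2⟩
    rw [Finset.prod_congr rfl fun i _ => (hi i).2, Finset.prod_const, Finset.card_range, hpA]
  -- the three cases: the norm is not contained in `D`, equals `D`, is strictly contained in `D`
  by_cases hZD : groupNorm (P : Subgroup G) ≤ D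
  swap
  · obtain ⟨s, hs, hsD, hsp⟩ := exists_mem_notMem_pow_mem P.isPGroup' hZD
    have hsN := norm_mem_normalizer hs D
    refine ⟨s, hsN, hsD, hsp, hinv s hsN fun y hy => ?_⟩
    have hy' := (Subgroup.mem_normalizer_iff''.mp hsN y).mp hy
    rw [hl _ hy, hl _ hy', apply_conj_eq_of_mem_groupNorm hp hA l hs hsp hy hy']
  rcases hZD.eq_or_lt with rfl | hZD
  · obtain ⟨s, -, hsD, hsp⟩ := exists_mem_notMem_pow_mem P.isPGroup' hDtop
    have hsN : s ∈ Subgroup.normalizer (groupNorm (P : Subgroup G) : Set P) := by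
      rw [Subgroup.normalizer_eq_top]; exact Subgroup.mem_top s
    refine ⟨s, hsN, hsD, hsp, fun y hy => ?_⟩
    rw [← prod_conj_groupNorm_eq_one hp hA l hsD hsp hy]
    exact Finset.prod_congr rfl fun i _ => hl _ _
  · have hN : ¬ Subgroup.normalizer (D : Set P) ≤ D := by
      have := P.isPGroup'.isNilpotent
      exact not_le_of_gt (Group.normalizerCondition_of_isNilpotent D
        (lt_top_iff_ne_top.mpr fun h => hDtop h.ge))
    obtain ⟨s, hs, hsD, hsp⟩ := exists_mem_notMem_pow_mem P.isPGroup' hN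
    obtain ⟨n, hn, hng⟩ := hfus (D.map (P : Subgroup G).subtype) (Subgroup.map_subtype_le D)
      ((Subgroup.map_lt_map_iff_of_injective (Subgroup.subtype_injective _)).mpr hZD) g⁻¹ (by
        rintro _ ⟨y, hy, rfl⟩
        rw [inv_inv]
        exact mem_of_conj_mem_normalizer y.2 ((hD y).mp hy))
    have hφ : ∀ y ∈ D, extendByOne φ (g⁻¹ * y * g) = extendByOne φ y := by
      intro y hy
      have := hng y ⟨y, hy, rfl⟩
      rw [inv_inv] at this
      rw [this, ← extendByOne_conj φ (inv_mem hn) y, inv_inv]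
    refine ⟨s, hs, hsD, hsp, hinv s hs fun y hy => ?_⟩
    rw [hφ _ hy, hφ _ ((Subgroup.mem_normalizer_iff''.mp hs y).mp hy)]
    exact extendByOne_conj φ (Subgroup.le_normalizer s.2) y

/-- Only the coset `N_G(P)` itself contributes to the product over all cosets. -/
theorem prod_extendByOne_eq [Fact p.Prime] [Finite G] {P : Sylow p G}
    (hfus : ∀ R : Subgroup G, R ≤ P →
      (groupNorm (P : Subgroup G)).map (P : Subgroup G).subtype < R → ∀ g : G,
      (∀ y ∈ R, g * y * g⁻¹ ∈ (P : Subgroup G)) → ActsAsNormalizer P R g)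
    {A : Type*} [CommGroup A] (hA : Nat.card A = p)
    (φ : Subgroup.normalizer ((P : Subgroup G) : Set G) →* A)
    [Fintype (G ⧸ Subgroup.normalizer ((P : Subgroup G) : Set G))] (x : P) :
    ∏ c : G ⧸ Subgroup.normalizer ((P : Subgroup G) : Set G),
      extendByOne φ (c.out⁻¹ * x * c.out) = extendByOne φ x := by
  classical
  have hp : p.Prime := Fact.out
  let N : Subgroup G := Subgroup.normalizer ((P : Subgroup G) : Set G)
  let S := MulAction.orbitRel P (G ⧸ N)
  have : Fintype (Quotient S) := Fintype.ofFinite _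
  have hPN : ∀ u : P, u • ((1 : G) : G ⧸ N) = ((1 : G) : G ⧸ N) := by
    intro u
    change ((u * 1 : G) : G ⧸ N) = _
    rw [eq_comm, QuotientGroup.eq]
    simp only [inv_one, one_mul, mul_one]
    exact Subgroup.le_normalizer u.2
  rw [← Finset.prod_fiberwise (s := Finset.univ) (g := fun c => (Quotient.mk S c)),
    Finset.prod_eq_single (Quotient.mk S ((1 : G) : G ⧸ N))]
  · have : Finset.univ.filter (fun c => Quotient.mk S c = Quotient.mk S ((1 : G) : G ⧸ N)) =
        {((1 : G) : G ⧸ N)} := by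
      ext c
      simp only [Finset.mem_filter, Finset.mem_univ, true_and, Finset.mem_singleton]
      constructor
      · intro h
        obtain ⟨u, hu⟩ := MulAction.orbitRel_apply.mp (Quotient.exact h)
        rw [← hu]
        exact hPN u
      · rintro rfl; rfl
    rw [this, Finset.prod_singleton, extendByOne_out_conj]
    simp
  · intro q _ hq
    obtain ⟨c, rfl⟩ := Quotient.exists_rep q
    induction c using QuotientGroup.induction_on with | H g =>
    have hg : g ∉ N := by
      intro hgN
      refine hq (congrArg _ ?_)
      rw [eq_comm, QuotientGroup.eq]
      simpa using hgN
    let D := MulAction.stabilizer P (g : G ⧸ N)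
    have hD : ∀ u : P, u ∈ D ↔ g⁻¹ * u * g ∈ N := by
      intro u
      change ((u * g : G) : G ⧸ N) = _ ↔ _
      rw [eq_comm, QuotientGroup.eq, mul_assoc]
    obtain ⟨s, hs, hsD, hsp, hprod⟩ := exists_prod_conj_eq_one hfus hA φ hg hD
    have : Fintype (P ⧸ D) := Fintype.ofFinite _
    have key := prod_quotient_eq_one hp D hs hsD hsp
      (fun c => extendByOne φ
        ((((MulAction.orbitEquivQuotientStabilizer P (g : G ⧸ N)).symm c : G ⧸ N)).out⁻¹ * x *
          (((MulAction.orbitEquivQuotientStabilizer P (g : G ⧸ N)).symm c : G ⧸ N)).out)) ?_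
    · rw [← key]
      symm
      refine Finset.prod_bij
        (fun c _ => ((MulAction.orbitEquivQuotientStabilizer P (g : G ⧸ N)).symm c : G ⧸ N))
        ?_ ?_ ?_ ?_
      · intro c _
        refine Finset.mem_filter.mpr ⟨Finset.mem_univ _, Quotient.sound ?_⟩
        exact MulAction.orbitRel_apply.mpr
          ((MulAction.orbitEquivQuotientStabilizer P (g : G ⧸ N)).symm c).2
      · intro a _ b _ hab
        exact (MulAction.orbitEquivQuotientStabilizer P (g : G ⧸ N)).symm.injective
          (Subtype.ext hab)
      · intro c hc
        have hc' := MulAction.orbitRel_apply.mp (Quotient.exact (Finset.mem_filter.mp hc).2)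
        exact ⟨MulAction.orbitEquivQuotientStabilizer P (g : G ⧸ N) ⟨c, hc'⟩, Finset.mem_univ _,
          by simp⟩
      · intro c _; rfl
    · intro u
      have hF : ∀ v : P, extendByOne φ
          ((((MulAction.orbitEquivQuotientStabilizer P (g : G ⧸ N)).symm (v : P ⧸ D)
            : G ⧸ N)).out⁻¹ * x *
          (((MulAction.orbitEquivQuotientStabilizer P (g : G ⧸ N)).symm (v : P ⧸ D)
            : G ⧸ N)).out) = extendByOne φ (g⁻¹ * (v⁻¹ * x * v : P) * g) := by
        intro v
        rw [MulAction.orbitEquivQuotientStabilizer_symm_apply]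
        change extendByOne φ (((v * g : G) : G ⧸ N).out⁻¹ * x * ((v * g : G) : G ⧸ N).out) = _
        rw [extendByOne_out_conj]
        congr 1
        simp [mul_assoc]
      simp only [hF]
      have he : ∀ i : ℕ, (u * s ^ i)⁻¹ * x * (u * s ^ i) = (s ^ i)⁻¹ * (u⁻¹ * x * u) * s ^ i :=
        fun i => by group
      simp only [he]
      by_cases hy : u⁻¹ * x * u ∈ D
      · exact hprod _ hy
      · refine Finset.prod_eq_one fun i _ => extendByOne_of_notMem φ fun hmem => hy ?_
        exact (Subgroup.mem_normalizer_iff''.mp (pow_mem hs i) _).mpr ((hD _).mpr hmem)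
  · intro h; exact absurd (Finset.mem_univ _) h

/-- If all homomorphisms from `G` to `A` kill the normal subgroup `W`, then `φ` kills `P ∩ W`. The
proof is by induction on the order of `x`. -/
theorem apply_eq_one_of_mem [Fact p.Prime] [Finite G] {P : Sylow p G}
    (hfus : ∀ R : Subgroup G, R ≤ P →
      (groupNorm (P : Subgroup G)).map (P : Subgroup G).subtype < R → ∀ g : G,
      (∀ y ∈ R, g * y * g⁻¹ ∈ (P : Subgroup G)) → ActsAsNormalizer P R g)
    {A : Type*} [CommGroup A] (hA : Nat.card A = p)
    (φ : Subgroup.normalizer ((P : Subgroup G) : Set G) →* A) {W : Subgroup G} [W.Normal]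
    (hW : ∀ f : G →* A, W ≤ f.ker) {x : G} (hxP : x ∈ (P : Subgroup G)) (hxW : x ∈ W) :
    φ ⟨x, Subgroup.le_normalizer hxP⟩ = 1 := by
  have := Fintype.ofFinite (G ⧸ Subgroup.normalizer ((P : Subgroup G) : Set G))
  induction hn : orderOf x using Nat.strong_induction_on generalizing x with
  | _ n ih =>
  subst hn
  rw [← extendByOne_of_mem, ← prod_extendByOne_eq hfus hA φ ⟨x, hxP⟩,
    ← transfer_eq_prod_extendByOne]
  · exact hW _ hxW
  · intro c hc
    set k := Function.minimalPeriod (x • ·) c with hk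
    by_cases hmem : c.out⁻¹ * x ^ k * c.out ∈ Subgroup.normalizer ((P : Subgroup G) : Set G)
    · have hP := mem_of_conj_mem_normalizer (pow_mem hxP k) hmem
      have hdvd : k ∣ orderOf x := by
        apply Function.IsPeriodicPt.minimalPeriod_dvd
        change (x • ·)^[orderOf x] c = c
        rw [smul_iterate, pow_orderOf_eq_one]
        exact one_smul _ _
      have hpos := orderOf_pos x
      have hk0 : 0 < k := Nat.pos_of_dvd_of_pos hdvd hpos
      have hW' : c.out⁻¹ * x ^ k * c.out ∈ W :=
        Subgroup.Normal.conj_mem' inferInstance _ (pow_mem hxW k) _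
      rw [extendByOne_of_mem φ hmem]
      refine ih _ ?_ hP hW' rfl
      have : orderOf (c.out⁻¹ * x ^ k * c.out) = orderOf (x ^ k) := by
        have := (MulAut.conj c.out⁻¹).orderOf_eq (x ^ k)
        simpa using this
      rw [this, orderOf_pow_of_dvd hk0.ne' hdvd]
      exact Nat.div_lt_self hpos (by omega)
    · exact extendByOne_of_notMem φ hmem

/-! ### The residual `A^p` and control of transfer -/

theorem abelianPResidual_le_ker {A : Type*} [CommGroup A] (hA : IsPGroup p A) (f : G →* A) :
    abelianPResidual p G ≤ f.ker := by
  refine sInf_le ⟨inferInstance, ?_, fun a b => ?_⟩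
  · exact hA.of_injective _ (QuotientGroup.kerLift_injective f)
  · apply QuotientGroup.kerLift_injective f
    rw [map_mul, map_mul, mul_comm]

theorem quotient_abelianPResidual_mul_comm (a b : G ⧸ abelianPResidual p G) :
    a * b = b * a := by
  induction a using QuotientGroup.induction_on with | H a =>
  induction b using QuotientGroup.induction_on with | H b =>
  rw [← QuotientGroup.mk_mul, ← QuotientGroup.mk_mul, QuotientGroup.eq, abelianPResidual,
    Subgroup.mem_sInf]
  rintro K ⟨hK, -, hcomm⟩
  rw [← QuotientGroup.eq, QuotientGroup.mk_mul, QuotientGroup.mk_mul]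
  exact hcomm a b

/-- The abelian group structure on `G / A^p(G)`. -/
instance quotientAbelianPResidualCommGroup (p : ℕ) (G : Type*) [Group G] :
    CommGroup (G ⧸ abelianPResidual p G) :=
  { (inferInstance : Group (G ⧸ abelianPResidual p G)) with
    mul_comm := quotient_abelianPResidual_mul_comm }

theorem isPGroup_quotient_abelianPResidual [Fact p.Prime] [Finite G] :
    IsPGroup p (G ⧸ abelianPResidual p G) := by
  intro a
  induction a using QuotientGroup.induction_on with | H a =>
  refine ⟨Nat.card G, ?_⟩
  rw [← QuotientGroup.mk_pow, QuotientGroup.eq_one_iff, abelianPResidual, Subgroup.mem_sInf]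
  rintro K ⟨hK, hp, -⟩
  rw [← QuotientGroup.eq_one_iff, QuotientGroup.mk_pow]
  obtain ⟨k, hk⟩ := IsPGroup.iff_orderOf.mp hp a
  rw [← orderOf_dvd_iff_pow_eq_one, hk]
  refine pow_dvd_pow _ ?_
  have h1 : p ^ k ≤ Nat.card G :=
    hk ▸ Nat.le_of_dvd Nat.card_pos ((orderOf_map_dvd (QuotientGroup.mk' K) a).trans
      (orderOf_dvd_natCard a))
  exact (Nat.lt_pow_self (Fact.out : p.Prime).one_lt).le.trans h1

theorem transfer_comp_subtype {A : Type*} [CommGroup A] (H : Subgroup G) [H.FiniteIndex]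
    (f : G →* A) (g : G) : (f.comp H.subtype).transfer g = f g ^ H.index := by
  classical
  have := H.fintypeQuotientOfFiniteIndex
  have : Fintype (Quotient (MulAction.orbitRel (Subgroup.zpowers g) (G ⧸ H))) :=
    Fintype.ofFinite _
  rw [MonoidHom.transfer_eq_prod_quotient_orbitRel_zpowers_quot,
    Subgroup.index_eq_sum_minimalPeriod H g, ← Finset.prod_pow_eq_pow_sum]
  refine Finset.prod_congr rfl fun q _ => ?_
  simp only [MonoidHom.comp_apply, Subgroup.subtype_apply, map_mul, map_inv, map_pow]
  rw [mul_right_comm, inv_mul_cancel, one_mul]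

theorem map_transfer {A B : Type*} [CommGroup A] [CommGroup B] {H : Subgroup G} [H.FiniteIndex]
    (φ : H →* A) (f : A →* B) (g : G) : f (φ.transfer g) = (f.comp φ).transfer g := by
  classical
  have := H.fintypeQuotientOfFiniteIndex
  have : Fintype (Quotient (MulAction.orbitRel (Subgroup.zpowers g) (G ⧸ H))) :=
    Fintype.ofFinite _
  rw [MonoidHom.transfer_eq_prod_quotient_orbitRel_zpowers_quot,
    MonoidHom.transfer_eq_prod_quotient_orbitRel_zpowers_quot, map_prod]
  rfl

theorem exists_subgroup_card_quotient_eq [Fact p.Prime] {B : Type*} [CommGroup B] [Finite B]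
    (hB : IsPGroup p B) [Nontrivial B] :
    ∃ M : Subgroup B, Nat.card (B ⧸ M) = p := by
  obtain ⟨n, hn⟩ := hB.exists_card_eq
  rcases n with _ | n
  · rw [pow_zero] at hn
    exact absurd hn Finite.one_lt_card.ne'
  obtain ⟨M, hM⟩ := Sylow.exists_subgroup_card_pow_prime (G := B) p (n := n)
    (hn ▸ pow_dvd_pow p n.le_succ)
  refine ⟨M, ?_⟩
  have := M.card_eq_card_quotient_mul_card_subgroup
  rw [hM, hn, pow_succ'] at this
  exact (Nat.eq_of_mul_eq_mul_right (pow_pos (Fact.out : p.Prime).pos n) this).symm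

/-- Control of `p`-transfer can be tested on homomorphisms to groups of order `p`. This uses that
the kernel of `N / A^p(N) → G / A^p(G)` is a direct factor, as the transfer shows. -/
theorem controlsPTransfer_of_forall.{u} {G : Type u} [Group G] [Fact p.Prime] [Finite G]
    {N : Subgroup G} (hN : p.Coprime N.index)
    (h : ∀ A : Type u, ∀ [CommGroup A], Nat.card A = p → ∀ φ : N →* A, ∀ x : N,
      (x : G) ∈ abelianPResidual p G → φ x = 1) : ControlsPTransfer p N := by
  let W := abelianPResidual p G
  let θ : N →* G ⧸ W := (QuotientGroup.mk' W).comp N.subtype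
  have hWp : IsPGroup p (G ⧸ W) := isPGroup_quotient_abelianPResidual
  have hθ : Function.Surjective θ := by
    rw [← MonoidHom.range_eq_top, ← Subgroup.index_eq_one]
    have h1 : θ.range.index ∣ N.index := by
      have e : θ.range = N.map (QuotientGroup.mk' W) := by
        rw [MonoidHom.range_eq_map, ← Subgroup.map_map, ← MonoidHom.range_eq_map,
          Subgroup.range_subtype]
      rw [e]
      exact Subgroup.index_map_dvd N (QuotientGroup.mk'_surjective W)
    obtain ⟨n, hn⟩ := hWp.index θ.range
    refine Nat.eq_one_of_dvd_coprimes ((hN.pow_left n)) (hn ▸ dvd_rfl) h1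
  have hker : abelianPResidual p N = θ.ker := by
    refine le_antisymm (abelianPResidual_le_ker hWp θ) fun y hy => ?_
    by_contra hyN
    let π : N ⧸ abelianPResidual p N →* G ⧸ W :=
      QuotientGroup.lift _ θ (abelianPResidual_le_ker hWp θ)
    let V : G →* N ⧸ abelianPResidual p N := (QuotientGroup.mk' (abelianPResidual p N)).transfer
    have hNp : IsPGroup p (N ⧸ abelianPResidual p N) := isPGroup_quotient_abelianPResidual
    have hVW : W ≤ V.ker := abelianPResidual_le_ker hNp V
    have hπ : ∀ g : N, π (V g) = θ g ^ N.index := fun g => by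
      rw [map_transfer]
      exact transfer_comp_subtype N (QuotientGroup.mk' W) (g : G)
    -- by `hπ`, this map takes values in the kernel of `π`
    let ρ : N →* π.ker :=
      { toFun := fun g => ⟨(QuotientGroup.mk' (abelianPResidual p N) g) ^ N.index * (V g)⁻¹, by
          rw [MonoidHom.mem_ker, map_mul, map_inv, hπ, map_pow]
          exact mul_inv_cancel (θ g ^ N.index)⟩
        map_one' := by simp
        map_mul' := fun a b => Subtype.ext (by
          simp only [map_mul, Subgroup.coe_mul, mul_pow, mul_inv]
          exact mul_mul_mul_comm _ _ _ _) }
    have hnon : Nontrivial π.ker := by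
      refine ⟨⟨QuotientGroup.mk' _ y, hy⟩, 1, fun e => hyN ?_⟩
      exact (QuotientGroup.eq_one_iff y).mp (congrArg Subtype.val e)
    have hBp : IsPGroup p π.ker := hNp.to_subgroup _
    obtain ⟨M, hM⟩ := exists_subgroup_card_quotient_eq hBp
    have hMtop : ∃ b : π.ker, b ∉ M := by
      by_contra! hall
      rw [← Subgroup.index_eq_card, (Subgroup.eq_top_iff' M).mpr hall, Subgroup.index_top] at hM
      exact (Fact.out : p.Prime).one_lt.ne hM
    obtain ⟨⟨b, hb⟩, hbM⟩ := hMtop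
    obtain ⟨x, rfl⟩ := QuotientGroup.mk'_surjective _ b
    have hxW : (x : G) ∈ W := (QuotientGroup.eq_one_iff (x : G)).mp hb
    have hφ := h (π.ker ⧸ M) hM ((QuotientGroup.mk' M).comp ρ) x hxW
    have hρ : ρ x = ⟨QuotientGroup.mk' _ x, hb⟩ ^ N.index := by
      apply Subtype.ext
      change _ * (V x)⁻¹ = _
      rw [show V x = 1 from hVW hxW, inv_one, mul_one]
      rfl
    rw [MonoidHom.comp_apply, hρ, map_pow] at hφ
    have h1 : orderOf (QuotientGroup.mk' M ⟨QuotientGroup.mk' _ x, hb⟩) ∣ p :=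
      (orderOf_dvd_natCard _).trans hM.dvd
    have h2 := Nat.eq_one_of_dvd_coprimes hN h1 (orderOf_dvd_of_pow_eq_one hφ)
    exact hbM ((QuotientGroup.eq_one_iff _).mp (orderOf_eq_one_iff.mp h2))
  exact ⟨hN, ⟨(QuotientGroup.quotientMulEquivOfEq hker).trans
    (QuotientGroup.quotientKerEquivOfSurjective θ hθ)⟩⟩

/-- A homomorphism to a group of order `p` is trivial at `x` if it is trivial at the `p`-part
of `x`. -/
theorem apply_eq_one_of_forall_sylow [Fact p.Prime] [Finite G] {P : Sylow p G}
    {A : Type*} [CommGroup A] (hA : Nat.card A = p)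
    (φ : Subgroup.normalizer ((P : Subgroup G) : Set G) →* A) {W : Subgroup G}
    (h : ∀ (x : G) (hx : x ∈ (P : Subgroup G)), x ∈ W →
      φ ⟨x, Subgroup.le_normalizer hx⟩ = 1)
    (x : Subgroup.normalizer ((P : Subgroup G) : Set G)) (hx : (x : G) ∈ W) : φ x = 1 := by
  have hp : p.Prime := Fact.out
  obtain ⟨k, m, hm, hk⟩ := Nat.exists_eq_pow_mul_and_not_dvd (orderOf_pos x).ne' p hp.ne_one
  have hpm : IsPGroup p (Subgroup.zpowers ((x : G) ^ m)) := by
    refine IsPGroup.of_card (n := k) ?_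
    have h0 : 0 < m := Nat.pos_of_ne_zero fun h => hm (h ▸ dvd_zero p)
    rw [Nat.card_zpowers, orderOf_pow_of_dvd h0.ne', Subgroup.orderOf_coe, hk,
      Nat.mul_div_cancel _ h0]
    rw [Subgroup.orderOf_coe, hk]
    exact dvd_mul_left _ _
  have hmP : (x : G) ^ m ∈ (P : Subgroup G) := by
    have := hpm.inf_normalizer_sylow P
    exact (this.le ⟨Subgroup.mem_zpowers _, pow_mem x.2 m⟩).2
  have h1 : φ x ^ m = 1 := by
    rw [← map_pow]
    exact h _ hmP (pow_mem hx m)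
  exact orderOf_eq_one_iff.mp (Nat.eq_one_of_dvd_coprimes ((hp.coprime_iff_not_dvd).mpr hm)
    ((orderOf_dvd_natCard (φ x)).trans hA.dvd) (orderOf_dvd_of_pow_eq_one h1))

end PTransfer

theorem mainTheorem2 (p : ℕ) (hp : p.Prime) (G : Type*) [Group G] [Finite G] (P : Sylow p G)
    (h : ∀ Q : Sylow p G, PTransfer.IsTameIntersection P Q →
      (PTransfer.groupNorm (P : Subgroup G)).map (P : Subgroup G).subtype
        < (P : Subgroup G) ⊓ (Q : Subgroup G) →
      (P : Subgroup G) ⊓ (Q : Subgroup G) < (P : Subgroup G) →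
      PTransfer.IsPNilpotent p
        (Subgroup.normalizer (((P : Subgroup G) ⊓ (Q : Subgroup G) : Subgroup G) : Set G))) :
    PTransfer.ControlsPTransfer p (Subgroup.normalizer ((P : Subgroup G) : Set G)) := by
  have := Fact.mk hp
  refine PTransfer.controlsPTransfer_of_forall ?_ fun A _ hA φ => ?_
  · refine (hp.coprime_iff_not_dvd).mpr fun hdvd => P.not_dvd_index ?_
    exact hdvd.trans (Subgroup.index_dvd_of_le Subgroup.le_normalizer)
  · refine PTransfer.apply_eq_one_of_forall_sylow hA φ fun x hxP hxW => ?_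
    exact PTransfer.apply_eq_one_of_mem
      (PTransfer.actsAsNormalizer_of_lt (fun n hn z => PTransfer.conj_mem_map_groupNorm hn) h)
      hA φ (PTransfer.abelianPResidual_le_ker (IsPGroup.of_card (n := 1) (by simpa using hA)))
      hxP hxW
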